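/- **Lemma 4.13.** Spacetime is either the light ray $\mathbb R$, with $O$ running over the nonempty bounded open intervals, or two-dimensional Minkowski spacetime, with $O$ running over the double cones. A point $p$ is left of $q$ if $p<q$, respectively if $p$ is spacelike to $q$ and has the smaller space coordinate. Write $S'$ for the causal complement of a set $S$ (on the light ray: its complement), and $W_L$, $W_R$ for the left and right connected components of $O'$. Let $O\mapsto\mathcal A(O)$ be an isotonous net of von Neumann algebras on a Hilbert space $H$ satisfying Haag duality $\mathcal A(O)=\mathcal A(O')'$, where $\mathcal A(O')$ is generated by the $\mathcal A(O_1)$ with $O_1\subset O'$ and a prime on an algebra denotes the commutant in $B(H)$, with quasilocal C*-algebra $\mathcal A$. A DHR endomorphism is a unital *-endomorphism $\rho$ of $\mathcal A$ that acts trivially on $\mathcal A(O')$ for some $O$ ("localized in $O$"), and such that for every $O$ there is a unitary $u\in\mathcal A$ (a transporter) with $\mathrm{Ad}_u\rho$ localized in $O$. An intertwiner $t:\rho\to\sigma$ is a $t\in\mathcal A$ with $t\rho(a)=\sigma(a)t$ for all $a\in\mathcal A$. The braiding is $\varepsilon^+_{\rho,\sigma}=\sigma(u_\rho^*)u_\sigma^*u_\rho\,\rho(u_\sigma)$,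 where $u_\rho,u_\sigma$ are transporters to regions $O_\rho,O_\sigma$ with $O_\sigma$ to the left of $O_\rho$ (the result does not depend on these choices), and $\varepsilon^-_{\rho,\sigma}=(\varepsilon^+_{\sigma,\rho})^*$. The dimension $\dim\rho$ is the infimum of the $d\ge 0$ for which there are a DHR endomorphism $\bar\rho$ and intertwiners $r:\mathrm{id}\to\bar\rho\rho$, $\bar r:\mathrm{id}\to\rho\bar\rho$ with $\bar r^*\rho(r)=1=r^*\bar\rho(\bar r)$ and $r^*r=\bar r^*\bar r=d\cdot 1$. A Q-system is a triple $(\theta,w,x)$ of a DHR endomorphism $\theta$ and intertwiners $w:\mathrm{id}\to\theta$, $x:\theta\to\theta^2$ such that $$w^*x=\theta(w^*)x=1,\quad xx=\theta(x)x,\quad xx^*=\theta(x^*)x,\quad w^*w=x^*x=\sqrt{\dim\theta}\cdot 1 .$$ The associated extension $\mathcal B$ is the *-algebra $\iota(\mathcal A)v$ with $v^*=\iota(w^*x^*)v$, $vv=\iota(x)v$, $\iota(w^*)v=1$, $v\iota(a)=\iota(\theta(a))v$, in its vacuum representation, i.e. on $H$ by $\iota(a)v\mapsto\theta(a)x$.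 Its local algebras are $\mathcal B(O)=\iota(\mathcal A(O))\,\iota(u)v$, where $u$ transports $\theta$ to $O$. It is called local if $\mathcal B(O_1)$ and $\mathcal B(O_2)$ commute whenever $O_1\subset O_2'$. For a wedge or halfray $W$, $\mathcal B(W)$ is the von Neumann algebra generated by the $\mathcal B(O)$, $O\subset W$. The left and right centres of $\mathcal B$ are the nets $$\mathcal B^+_{\rm loc}(O)=\mathcal B(W_L)'\cap\mathcal B(W_R'),\qquad \mathcal B^-_{\rm loc}(O)=\mathcal B(W_R)'\cap\mathcal B(W_L').$$ Let $(\theta_1,w_1,x_1)$ and $(\theta_2,w_2,x_2)$ be Q-systems with extensions $\mathcal B_1,\mathcal B_2$. Let $\mathcal C^\pm=\mathcal B_1\times^\pm\mathcal B_2$ be the extension, realized in the same way on $H$ by $\iota=\theta_1\theta_2$ and $v=x^\pm$, that belongs to the braided product $$\big(\theta_1\theta_2,\ \theta_1(w_2)w_1,\ x^\pm=\theta_1(\varepsilon^\pm_{\theta_1,\theta_2})\,x_1\,\theta_1(x_2)\big).$$ It contains the nets $\mathcal B_i$ as $\mathcal B_i(O)=\iota(\mathcal A(O))\,\iota(u_i)v_i$,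 with $v_1=\iota(\theta_1(w_2^*))v$, $v_2=\iota(w_1^*)v$, and $u_i$ a transporter of $\theta_i$ to $O$. If $\mathcal B_2$ is local, then for every $O$ $$\mathcal B_2(O)\subset(\mathcal C^+)^-_{\rm loc}(O),\qquad \mathcal B_2(O)\subset(\mathcal C^-)^+_{\rm loc}(O).$$ If $\mathcal B_1$ is local, then for every $O$ $$\mathcal B_1(O)\subset(\mathcal C^+)^+_{\rm loc}(O),\qquad \mathcal B_1(O)\subset(\mathcal C^-)^-_{\rm loc}(O).$$ -/

import Mathlib

noncomputable section

namespace BraidedQFT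

/-! ### Spacetime -/

/-- The two spacetimes under consideration: the light ray `ℝ` (chiral theories) and the
two-dimensional Minkowski spacetime (two-dimensional theories). -/
inductive Spacetime where
  | lightRay
  | minkowski

/-- Points: `x ∈ ℝ` on the light ray, pairs `(t, x)` in Minkowski spacetime. -/
def Point : Spacetime → Type
  | .lightRay => ℝ
  | .minkowski => ℝ × ℝ

/-- `LeftOf s p q`: on the light ray, `p` is in the past of `q`; in Minkowski spacetime, `p` is
spacelike to `q`, on its left. -/
def LeftOf : (s : Spacetime) → Point s → Point s → Prop
  | .lightRay => fun p q : ℝ => p < q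
  | .minkowski => fun p q : ℝ × ℝ => |p.1 - q.1| < q.2 - p.2

/-- The localization regions: nonempty bounded open intervals of the light ray, and double cones
`{(t, x) | t + x ∈ I, t - x ∈ J}` of Minkowski spacetime, with `I`, `J` such intervals. -/
def IsRegion : (s : Spacetime) → Set (Point s) → Prop
  | .lightRay => fun O : Set ℝ => ∃ a b : ℝ, a < b ∧ O = Set.Ioo a b
  | .minkowski => fun O : Set (ℝ × ℝ) => ∃ a b c d : ℝ, a < b ∧ c < d ∧
      O = {p | p.1 + p.2 ∈ Set.Ioo a b ∧ p.1 - p.2 ∈ Set.Ioo c d}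

/-- The type of intervals, resp. double cones. -/
def Region (s : Spacetime) : Type := {O : Set (Point s) // IsRegion s O}

/-- The causal complement of a set (on the light ray: the complement). -/
def causalCompl {s : Spacetime} (S : Set (Point s)) : Set (Point s) :=
  {p | ∀ q ∈ S, LeftOf s p q ∨ LeftOf s q p}

/-- The left component `W_L` of the causal complement of a region (a wedge, resp. a halfray). -/
def leftWedge {s : Spacetime} (O : Region s) : Set (Point s) :=
  {p | ∀ q ∈ O.1, LeftOf s p q}

/-- The right component `W_R` of the causal complement of a region. -/
def rightWedge {s : Spacetime} (O : Region s) : Set (Point s) :=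
  {p | ∀ q ∈ O.1, LeftOf s q p}

theorem exists_region_union {s : Spacetime} (O₁ O₂ : Region s) :
    ∃ O : Region s, O₁.1 ⊆ O.1 ∧ O₂.1 ⊆ O.1 := by
  obtain ⟨O₁, h₁⟩ := O₁
  obtain ⟨O₂, h₂⟩ := O₂
  cases s with
  | lightRay =>
    obtain ⟨a, b, hab, rfl⟩ := h₁
    obtain ⟨a', b', hab', rfl⟩ := h₂
    refine ⟨⟨Set.Ioo (α := ℝ) (min a a') (max b b'), _, _, ?_, rfl⟩, ?_, ?_⟩
    · simp [hab]
    · exact Set.Ioo_subset_Ioo (α := ℝ) (min_le_left _ _) (le_max_left _ _)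
    · exact Set.Ioo_subset_Ioo (α := ℝ) (min_le_right _ _) (le_max_right _ _)
  | minkowski =>
    obtain ⟨a, b, c, d, hab, hcd, rfl⟩ := h₁
    obtain ⟨a', b', c', d', hab', hcd', rfl⟩ := h₂
    refine ⟨⟨{p | p.1 + p.2 ∈ Set.Ioo (min a a') (max b b') ∧
      p.1 - p.2 ∈ Set.Ioo (min c c') (max d d')}, _, _, _, _, ?_, ?_, rfl⟩, ?_, ?_⟩
    · simp [hab]
    · simp [hcd]
    · exact fun p hp => ⟨Set.Ioo_subset_Ioo (min_le_left _ _) (le_max_left _ _) hp.1,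
        Set.Ioo_subset_Ioo (min_le_left _ _) (le_max_left _ _) hp.2⟩
    · exact fun p hp => ⟨Set.Ioo_subset_Ioo (min_le_right _ _) (le_max_right _ _) hp.1,
        Set.Ioo_subset_Ioo (min_le_right _ _) (le_max_right _ _) hp.2⟩

theorem exists_left_region (s : Spacetime) :
    ∃ O₁ O₂ : Region s, O₁.1 ⊆ leftWedge O₂ := by
  cases s with
  | lightRay =>
    refine ⟨⟨Set.Ioo (α := ℝ) 0 1, 0, 1, by norm_num, rfl⟩,
      ⟨Set.Ioo (α := ℝ) 1 2, 1, 2, by norm_num, rfl⟩, ?_⟩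
    intro p hp q hq
    exact lt_trans hp.2 hq.1
  | minkowski =>
    refine ⟨⟨{p | p.1 + p.2 ∈ Set.Ioo (0 : ℝ) 1 ∧ p.1 - p.2 ∈ Set.Ioo (1 : ℝ) 2},
        0, 1, 1, 2, by norm_num, by norm_num, rfl⟩,
      ⟨{p | p.1 + p.2 ∈ Set.Ioo (1 : ℝ) 2 ∧ p.1 - p.2 ∈ Set.Ioo (0 : ℝ) 1},
        1, 2, 0, 1, by norm_num, by norm_num, rfl⟩, ?_⟩
    rintro p ⟨⟨h1, h2⟩, h3, h4⟩ q ⟨⟨h5, h6⟩, h7, h8⟩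
    change |p.1 - q.1| < q.2 - p.2
    rw [abs_lt]
    constructor <;> linarith

/-! ### Haag dual nets -/

/-- A Haag dual net of von Neumann algebras on the Hilbert space `H`: isotony, and Haag duality
`A(O) = A(O')'` (which contains locality). Nothing is assumed about covariance or the vacuum:
what follows needs neither. -/
structure Net (s : Spacetime) (H : Type*) [NormedAddCommGroup H] [InnerProductSpace ℂ H]
    [CompleteSpace H] where
  alg : Region s → VonNeumannAlgebra H
  isotone : ∀ O₁ O₂ : Region s, O₁.1 ⊆ O₂.1 →
    (alg O₁ : Set (H →L[ℂ] H)) ⊆ (alg O₂ : Set (H →L[ℂ] H))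
  haag : ∀ O : Region s, (alg O : Set (H →L[ℂ] H)) =
    Set.centralizer (⋃ O₁ : {O₁ : Region s // O₁.1 ⊆ causalCompl O.1},
      (alg O₁.1 : Set (H →L[ℂ] H)))

variable {s : Spacetime} {H : Type*} [NormedAddCommGroup H] [InnerProductSpace ℂ H]
  [CompleteSpace H]

/-- The quasilocal C*-algebra of the net: the norm closure of the *-algebra generated by all
local algebras. -/
def Net.quasi (A : Net s H) : StarSubalgebra ℂ (H →L[ℂ] H) :=
  (⨆ O : Region s, (A.alg O).toStarSubalgebra).topologicalClosure

/-- `u` is a charge transporter for `ρ` to the region `O`: it is unitary, and `Ad_u ∘ ρ` is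
localized in `O`, i.e. acts trivially on the observables of the causal complement of `O`. -/
def Net.IsTransporter (A : Net s H) (ρ : A.quasi →⋆ₐ[ℂ] A.quasi) (u : A.quasi)
    (O : Region s) : Prop :=
  u ∈ unitary A.quasi ∧ ∀ O₁ : Region s, O₁.1 ⊆ causalCompl O.1 →
    ∀ a : A.quasi, (a : H →L[ℂ] H) ∈ A.alg O₁ → u * ρ a * star u = a

/-- DHR endomorphisms: unital *-endomorphisms of the quasilocal algebra that are localized in
some region and can be transported to every region by a unitary charge transporter. -/
structure DHREndo (A : Net s H) where
  toHom : A.quasi →⋆ₐ[ℂ] A.quasi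
  localized : ∃ O : Region s, ∀ O₁ : Region s, O₁.1 ⊆ causalCompl O.1 →
    ∀ a : A.quasi, (a : H →L[ℂ] H) ∈ A.alg O₁ → toHom a = a
  transportable : ∀ O : Region s, ∃ u : A.quasi, A.IsTransporter toHom u O

theorem causalCompl_anti {S T : Set (Point s)} (h : S ⊆ T) : causalCompl T ⊆ causalCompl S :=
  fun _ hp q hq => hp q (h hq)

variable {A : Net s H}

/-- The composition (fusion) `ρσ = ρ ∘ σ` of DHR endomorphisms. -/
def DHREndo.comp (ρ σ : DHREndo A) : DHREndo A where
  toHom := ρ.toHom.comp σ.toHom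
  localized := by
    obtain ⟨O, hO⟩ := ρ.localized
    obtain ⟨P, hP⟩ := σ.localized
    obtain ⟨Q, hOQ, hPQ⟩ := exists_region_union O P
    refine ⟨Q, fun O₁ h a ha => ?_⟩
    change ρ.toHom (σ.toHom a) = a
    rw [hP O₁ (h.trans (causalCompl_anti hPQ)) a ha, hO O₁ (h.trans (causalCompl_anti hOQ)) a ha]
  transportable := by
    intro O
    obtain ⟨u, hu, hu'⟩ := ρ.transportable O
    obtain ⟨v, hv, hv'⟩ := σ.transportable O
    refine ⟨u * ρ.toHom v, mul_mem hu ?_, fun O₁ h a ha => ?_⟩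
    · rw [Unitary.mem_iff] at hv ⊢
      rw [← map_star, ← map_mul, ← map_mul, hv.1, hv.2, map_one]
      exact ⟨rfl, rfl⟩
    · change u * ρ.toHom v * ρ.toHom (σ.toHom a) * star (u * ρ.toHom v) = a
      rw [star_mul, ← map_star]
      calc u * ρ.toHom v * ρ.toHom (σ.toHom a) * (ρ.toHom (star v) * star u)
          = u * ρ.toHom (v * σ.toHom a * star v) * star u := by
            simp only [map_mul, mul_assoc]
        _ = a := by rw [hv' O₁ h a ha, hu' O₁ h a ha]

/-- `Hom(ρ, σ)`: the intertwiners `t : ρ → σ`. -/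
def Intertwines (ρ σ : A.quasi →⋆ₐ[ℂ] A.quasi) (t : A.quasi) : Prop :=
  ∀ a : A.quasi, t * ρ a = σ a * t

/-! ### Statistics operators -/

/-- `e = σ(u_ρ*) u_σ* u_ρ ρ(u_σ)` for charge transporters `u_ρ`, `u_σ` to auxiliary regions such
that the one for `σ` is to the left of the one for `ρ`. -/
def IsStatOp (ρ σ : DHREndo A) (e : A.quasi) : Prop :=
  ∃ (Oρ Oσ : Region s) (uρ uσ : A.quasi), Oσ.1 ⊆ leftWedge Oρ ∧
    A.IsTransporter ρ.toHom uρ Oρ ∧ A.IsTransporter σ.toHom uσ Oσ ∧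
    e = σ.toHom (star uρ) * star uσ * uρ * ρ.toHom uσ

theorem exists_isStatOp (ρ σ : DHREndo A) : ∃ e, IsStatOp ρ σ e := by
  obtain ⟨O₁, O₂, h⟩ := exists_left_region s
  obtain ⟨u, hu⟩ := ρ.transportable O₂
  obtain ⟨v, hv⟩ := σ.transportable O₁
  exact ⟨_, O₂, O₁, u, v, h, hu, hv, rfl⟩

/-- The braiding `ε⁺_{ρ,σ} : ρσ → σρ` (it does not depend on the auxiliary choices). -/
def braidPlus (ρ σ : DHREndo A) : A.quasi := (exists_isStatOp ρ σ).choose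

/-- The opposite braiding `ε⁻_{ρ,σ} = (ε⁺_{σ,ρ})*`. -/
def braidMinus (ρ σ : DHREndo A) : A.quasi := star (braidPlus σ ρ)

/-! ### Q-systems -/

/-- A normalized solution `(r, r')` of the conjugacy relations for `ρ` and `ρ'`:
`r : id → ρ'ρ`, `r' : id → ρρ'`, `r'* ρ(r) = 1 = r* ρ'(r')`, `r* r = r'* r' = d`. -/
def IsConjugateSolution (ρ ρ' : DHREndo A) (r r' : A.quasi) (d : ℝ) : Prop :=
  Intertwines (StarAlgHom.id ℂ A.quasi) (ρ'.comp ρ).toHom r ∧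
  Intertwines (StarAlgHom.id ℂ A.quasi) (ρ.comp ρ').toHom r' ∧
  star r' * ρ.toHom r = 1 ∧ star r * ρ'.toHom r' = 1 ∧
  star r * r = algebraMap ℂ A.quasi (d : ℂ) ∧ star r' * r' = algebraMap ℂ A.quasi (d : ℂ)

/-- The dimension of `ρ`: the infimum of `d` over the normalized solutions of the conjugacy
relations. -/
def DHREndo.dim (ρ : DHREndo A) : ℝ :=
  sInf {d : ℝ | 0 ≤ d ∧ ∃ (ρ' : DHREndo A) (r r' : A.quasi), IsConjugateSolution ρ ρ' r r' d}

/-- A triple `(θ, w, x)` of a DHR endomorphism and two quasilocal observables. -/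
structure Triple (A : Net s H) where
  θ : DHREndo A
  w : A.quasi
  x : A.quasi

/-- The triple is a Q-system. (The solution `r = r' = x w` of the conjugacy relations shows that
`θ` then has finite dimension.) -/
structure Triple.IsQSystem (T : Triple A) : Prop where
  w_hom : Intertwines (StarAlgHom.id ℂ A.quasi) T.θ.toHom T.w
  x_hom : Intertwines T.θ.toHom (T.θ.comp T.θ).toHom T.x
  unit_left : star T.w * T.x = 1
  unit_right : T.θ.toHom (star T.w) * T.x = 1
  assoc : T.x * T.x = T.θ.toHom T.x * T.x
  frobenius : T.x * star T.x = T.θ.toHom (star T.x) * T.x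
  standard_w : star T.w * T.w = algebraMap ℂ A.quasi (Real.sqrt T.θ.dim : ℂ)
  standard_x : star T.x * T.x = algebraMap ℂ A.quasi (Real.sqrt T.θ.dim : ℂ)

/-- The product `(θ₁θ₂, θ₁(w₂)w₁, θ₁(e) x₁ θ₁(x₂))` of two triples with respect to
`e : θ₁θ₂ → θ₂θ₁`. -/
def Triple.prodWith (T₁ T₂ : Triple A) (e : A.quasi) : Triple A where
  θ := T₁.θ.comp T₂.θ
  w := T₁.θ.toHom T₂.w * T₁.w
  x := T₁.θ.toHom e * T₁.x * T₁.θ.toHom T₂.x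

/-- The braided product `×⁺`. -/
def Triple.prodPlus (T₁ T₂ : Triple A) : Triple A := T₁.prodWith T₂ (braidPlus T₁.θ T₂.θ)

/-- The braided product `×⁻`. -/
def Triple.prodMinus (T₁ T₂ : Triple A) : Triple A := T₁.prodWith T₂ (braidMinus T₁.θ T₂.θ)

/-! ### Extensions -/

/-- The assignment `O ↦ ι(A(O)) · ι(u) v`, where `u` transports `θ` to `O`. -/
def chargedAlg (ι : A.quasi →⋆ₐ[ℂ] (H →L[ℂ] H)) (v : H →L[ℂ] H) (θ : DHREndo A)
    (O : Region s) : Set (H →L[ℂ] H) :=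
  {b | ∃ a u : A.quasi, (a : H →L[ℂ] H) ∈ A.alg O ∧ A.IsTransporter θ.toHom u O ∧
    b = ι a * (ι u * v)}

/-- The embedding `ι` of the observables into the extension `B` given by the Q-system
`(θ, w, x)`. The extension, abstractly `B = ι(A) v` with the relations
`v* = ι(w* x*) v`, `v v = ι(x) v`, `ι(w*) v = 1`, `v ι(a) = ι(θ(a)) v`, is realized in its vacuum
representation: on `H`, by the faithful representation `ι(a) v ↦ θ(a) x`. Thus `ι = θ` and
`v = x`. -/
def Triple.ι (T : Triple A) : A.quasi →⋆ₐ[ℂ] (H →L[ℂ] H) := A.quasi.subtype.comp T.θ.toHom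

/-- The generator `v` of the extension, in the vacuum representation. -/
def Triple.v (T : Triple A) : H →L[ℂ] H := (T.x : H →L[ℂ] H)

/-- The local algebras `B(O) = ι(A(O)) · ι(u) v` of the extension. -/
def Triple.ext (T : Triple A) : Region s → Set (H →L[ℂ] H) := chargedAlg T.ι T.v T.θ

/-- The copy of the net `B₁` in a product `C` of `B₁` and `B₂`; its generator is
`v₁ = ι(θ₁(w₂*)) v`. -/
def Triple.fstIn (T₁ T₂ C : Triple A) : Region s → Set (H →L[ℂ] H) :=
  chargedAlg C.ι (C.ι (T₁.θ.toHom (star T₂.w)) * C.v) T₁.θ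

/-- The copy of the net `B₂` in a product `C` of `B₁` and `B₂`; its generator is
`v₂ = ι(w₁*) v`. -/
def Triple.sndIn (T₁ T₂ C : Triple A) : Region s → Set (H →L[ℂ] H) :=
  chargedAlg C.ι (C.ι (star T₁.w) * C.v) T₂.θ

/-! ### Locality and the left and right centres -/

/-- A net is local if algebras of spacelike separated regions commute. -/
def IsLocalNet (B : Region s → Set (H →L[ℂ] H)) : Prop :=
  ∀ O₁ O₂ : Region s, O₁.1 ⊆ causalCompl O₂.1 → ∀ b₁ ∈ B O₁, ∀ b₂ ∈ B O₂, b₁ * b₂ = b₂ * b₁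

/-- The von Neumann algebra `B(S)` generated by the `B(O)`, `O ⊆ S`, for a (possibly unbounded)
set `S` such as a wedge: the double commutant of these operators and their adjoints. -/
def genAlg (B : Region s → Set (H →L[ℂ] H)) (S : Set (Point s)) : Set (H →L[ℂ] H) :=
  Set.centralizer (Set.centralizer {b | ∃ O : Region s, O.1 ⊆ S ∧ (b ∈ B O ∨ star b ∈ B O)})

/-- The left centre `B⁺_loc(O) = B(W_L)' ∩ B(W_R')`. -/
def leftCentre (B : Region s → Set (H →L[ℂ] H)) (O : Region s) : Set (H →L[ℂ] H) :=
  Set.centralizer (genAlg B (leftWedge O)) ∩ genAlg B (causalCompl (rightWedge O))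

/-- The right centre `B⁻_loc(O) = B(W_R)' ∩ B(W_L')`. -/
def rightCentre (B : Region s → Set (H →L[ℂ] H)) (O : Region s) : Set (H →L[ℂ] H) :=
  Set.centralizer (genAlg B (rightWedge O)) ∩ genAlg B (causalCompl (leftWedge O))

end BraidedQFT

end

noncomputable section

namespace BraidedQFT

/-! ### Regions on a given side of a region -/

/-! The generator of the braided product factorizes as v = v₁v₂, with v₁ = θ₁(e)x₁ and v₂ = θ₁(x₂),
e being the braiding (`fst_generator`, `snd_generator`). Up to observables in P, a charged field of
the product in P is therefore a product of charged fields of the two factors in P. A field of one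
factor in O thus commutes with the product in P once it commutes with three kinds of operators
(`commute_ext_prodWith`): the observables in P, by localization of the charge; the fields of the
same factor, by the assumed locality; and the fields of the other factor.

The last case is where the braiding enters. The generators satisfy v₂v₁ = ι(e)v₁v₂ (`snd_mul_fst`).
If the charge of the second factor lies on the side of the first that is used in defining e, then e
may be written with the transporters to the very regions of the two fields, and the exchange
relation becomes commutativity (`commute_fst_snd`). This requires that e not depend on the auxiliary
regions (`OnSide.isBraid`). The Boolean `d` records the side, so that both braidings and both
centres are treated at once.

For the commutant half of a centre, adjoints must be controlled too; they are again charged fields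
(`exists_star_charged`). The other half follows from B₁(O), B₂(O) ⊆ C(O). -/

/-- The left (`d = true`), resp. right (`d = false`), component of the causal complement of `O`. -/
def sideWedge {s : Spacetime} (d : Bool) (O : Region s) : Set (Point s) :=
  if d then leftWedge O else rightWedge O

/-- The region `P` is to the left (`d = true`), resp. to the right (`d = false`), of `O`. -/
def OnSide {s : Spacetime} (d : Bool) (P O : Region s) : Prop :=
  P.1 ⊆ sideWedge d O

theorem subset_causalCompl_sideWedge {s : Spacetime} (d : Bool) (O : Region s) :
    O.1 ⊆ causalCompl (sideWedge d O) := by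
  cases d
  · exact fun p hp q hq => Or.inl (hq p hp)
  · exact fun p hp q hq => Or.inr (hq p hp)

theorem OnSide.symm {s : Spacetime} {d : Bool} {P O : Region s} (h : OnSide d P O) :
    OnSide (!d) O P := by
  cases d
  · exact fun p hp q hq => h hq p hp
  · exact fun p hp q hq => h hq p hp

theorem OnSide.subset_causalCompl {s : Spacetime} {d : Bool} {P O : Region s}
    (h : OnSide d P O) : P.1 ⊆ causalCompl O.1 := by
  cases d
  · exact fun p hp q hq => Or.inr (h hp q hq)
  · exact fun p hp q hq => Or.inl (h hp q hq)

theorem OnSide.mono {s : Spacetime} {d : Bool} {P O O' : Region s} (h : OnSide d P O)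
    (hO : O'.1 ⊆ O.1) : OnSide d P O' := by
  cases d
  · exact fun p hp q hq => h hp q (hO hq)
  · exact fun p hp q hq => h hp q (hO hq)

/-! ### Left and right in light-cone coordinates -/

theorem leftOf_minkowski_iff {p q : ℝ × ℝ} :
    LeftOf .minkowski p q ↔ p.1 + p.2 < q.1 + q.2 ∧ q.1 - q.2 < p.1 - p.2 := by
  change |p.1 - q.1| < q.2 - p.2 ↔ _
  rw [abs_lt]
  constructor <;> rintro ⟨h₁, h₂⟩ <;> constructor <;> linarith

/-- The double cone `{(t, x) | t + x ∈ (a, b), t - x ∈ (c, d)}`. -/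
def doubleCone (a b c d : ℝ) (hab : a < b) (hcd : c < d) : Region .minkowski :=
  ⟨{p | p.1 + p.2 ∈ Set.Ioo a b ∧ p.1 - p.2 ∈ Set.Ioo c d}, a, b, c, d, hab, hcd, rfl⟩

theorem exists_lightCone_coords (m n : ℝ) : ∃ p : ℝ × ℝ, p.1 + p.2 = m ∧ p.1 - p.2 = n :=
  ⟨((m + n) / 2, (m - n) / 2), by ring, by ring⟩

/-- The order decouples in the coordinates t + x and t − x into two comparisons of open intervals.
The bounds are not strict because the intervals are open: regions that touch are still separated. -/
theorem doubleCone_leftOf_iff {a b c d a' b' c' d' : ℝ} {hab : a < b} {hcd : c < d}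
    {hab' : a' < b'} {hcd' : c' < d'} :
    (∀ p ∈ (doubleCone a b c d hab hcd).1, ∀ q ∈ (doubleCone a' b' c' d' hab' hcd').1,
      LeftOf .minkowski p q) ↔ b ≤ a' ∧ d' ≤ c := by
  constructor
  · intro h
    have key : ∀ m ∈ Set.Ioo a b, ∀ n ∈ Set.Ioo c d, ∀ m' ∈ Set.Ioo a' b', ∀ n' ∈ Set.Ioo c' d',
        m < m' ∧ n' < n := by
      intro m hm n hn m' hm' n' hn'
      obtain ⟨p, hp1, hp2⟩ := exists_lightCone_coords m n
      obtain ⟨q, hq1, hq2⟩ := exists_lightCone_coords m' n'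
      have := leftOf_minkowski_iff.1 (h p ⟨hp1 ▸ hm, hp2 ▸ hn⟩ q ⟨hq1 ▸ hm', hq2 ▸ hn'⟩)
      rwa [hp1, hp2, hq1, hq2] at this
    obtain ⟨m, hm⟩ := exists_between hab
    obtain ⟨n, hn⟩ := exists_between hcd
    obtain ⟨m', hm'⟩ := exists_between hab'
    obtain ⟨n', hn'⟩ := exists_between hcd'
    constructor
    · by_contra! hlt
      -- If a' < b, some y of the second interval lies below b. It may lie below a as well, so `max
      -- y m`, with m in the first interval, is the violating point.
      obtain ⟨y, hy⟩ := exists_between (lt_min hlt hab')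
      have hy2 := lt_min_iff.1 hy.2
      have := (key (max y m) ⟨lt_max_of_lt_right hm.1, max_lt hy2.1 hm.2⟩ n hn y
        ⟨hy.1, hy2.2⟩ n' hn').1
      exact absurd this (not_lt.2 (le_max_left _ _))
    · by_contra! hlt
      obtain ⟨y, hy⟩ := exists_between (lt_min hlt hcd)
      have hy2 := lt_min_iff.1 hy.2
      have := (key m hm y ⟨hy.1, hy2.2⟩ m' hm' (max y n')
        ⟨lt_max_of_lt_right hn'.1, max_lt hy2.1 hn'.2⟩).2
      exact absurd this (not_lt.2 (le_max_left _ _))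
  · rintro ⟨h₁, h₂⟩ p ⟨hp1, hp2⟩ q ⟨hq1, hq2⟩
    exact leftOf_minkowski_iff.2 ⟨(hp1.2.trans_le h₁).trans hq1.1, (hq2.2.trans_le h₂).trans hp2.1⟩

/-- The interval `(a, b)` of the light ray. -/
def interval (a b : ℝ) (hab : a < b) : Region .lightRay :=
  ⟨(Set.Ioo a b : Set ℝ), a, b, hab, rfl⟩

theorem interval_leftOf_iff {a b a' b' : ℝ} {hab : a < b} {hab' : a' < b'} :
    (∀ p ∈ (interval a b hab).1, ∀ q ∈ (interval a' b' hab').1, LeftOf .lightRay p q) ↔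
      b ≤ a' := by
  constructor
  · intro h
    obtain ⟨m, hm⟩ := exists_between hab
    by_contra! hlt
    obtain ⟨y, hy⟩ := exists_between (lt_min hlt hab')
    have hy2 := lt_min_iff.1 hy.2
    have : max y m < y := h (max y m : ℝ) ⟨lt_max_of_lt_right hm.1, max_lt hy2.1 hm.2⟩ y
      ⟨hy.1, hy2.2⟩
    exact absurd this (not_lt.2 (le_max_left _ _))
  · intro h
    have key : ∀ p q : ℝ, p < b → a' < q → p < q := fun p q hp hq => (hp.trans_le h).trans hq
    exact fun p hp q hq => key p q hp.2 hq.1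

theorem interval_subset {a b a' b' : ℝ} {hab : a < b} {hab' : a' < b'} (h₁ : a' ≤ a)
    (h₂ : b ≤ b') : (interval a b hab).1 ⊆ (interval a' b' hab').1 :=
  Set.Ioo_subset_Ioo (α := ℝ) h₁ h₂

theorem doubleCone_subset {a b c d a' b' c' d' : ℝ} {hab : a < b} {hcd : c < d}
    {hab' : a' < b'} {hcd' : c' < d'} (h₁ : a' ≤ a) (h₂ : b ≤ b') (h₃ : c' ≤ c) (h₄ : d ≤ d') :
    (doubleCone a b c d hab hcd).1 ⊆ (doubleCone a' b' c' d' hab' hcd').1 :=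
  fun _ hp => ⟨Set.Ioo_subset_Ioo h₁ h₂ hp.1, Set.Ioo_subset_Ioo h₃ h₄ hp.2⟩

/-- The regions on one side of a region are directed. -/
theorem OnSide.exists_union {s : Spacetime} {d : Bool} {P P' O : Region s} (h : OnSide d P O)
    (h' : OnSide d P' O) : ∃ R : Region s, P.1 ⊆ R.1 ∧ P'.1 ⊆ R.1 ∧ OnSide d R O := by
  obtain ⟨P, hP⟩ := P
  obtain ⟨P', hP'⟩ := P'
  obtain ⟨O, hO⟩ := O
  cases s with
  | lightRay =>
    obtain ⟨a, b, hab, rfl⟩ := hP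
    obtain ⟨a', b', hab', rfl⟩ := hP'
    obtain ⟨k, l, hkl, rfl⟩ := hO
    -- The hull of the two intervals works: lying on a given side of O is an inequality between
    -- endpoints, and it survives `min` and `max`. The same holds below in each light-cone
    -- coordinate.
    refine ⟨interval (min a a') (max b b') (lt_of_le_of_lt (min_le_left _ _)
      (hab.trans_le (le_max_left _ _))), interval_subset (hab := hab) (min_le_left _ _)
      (le_max_left _ _), interval_subset (hab := hab') (min_le_right _ _) (le_max_right _ _), ?_⟩
    cases d
    · have h₁ := interval_leftOf_iff (hab := hkl) (hab' := hab).1 fun p hp q hq => h hq p hp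
      have h₂ := interval_leftOf_iff (hab := hkl) (hab' := hab').1 fun p hp q hq => h' hq p hp
      exact fun p hp q hq => interval_leftOf_iff (hab := hkl).2 (le_min h₁ h₂) q hq p hp
    · have h₁ := interval_leftOf_iff (hab := hab) (hab' := hkl).1 fun p hp q hq => h hp q hq
      have h₂ := interval_leftOf_iff (hab := hab') (hab' := hkl).1 fun p hp q hq => h' hp q hq
      exact fun p hp q hq => interval_leftOf_iff (hab' := hkl).2 (max_le h₁ h₂) p hp q hq
  | minkowski =>
    obtain ⟨a, b, c, e, hab, hce, rfl⟩ := hP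
    obtain ⟨a', b', c', e', hab', hce', rfl⟩ := hP'
    obtain ⟨k, l, m, n, hkl, hmn, rfl⟩ := hO
    refine ⟨doubleCone (min a a') (max b b') (min c c') (max e e')
      (lt_of_le_of_lt (min_le_left _ _) (hab.trans_le (le_max_left _ _)))
      (lt_of_le_of_lt (min_le_left _ _) (hce.trans_le (le_max_left _ _))),
      doubleCone_subset (hab := hab) (hcd := hce) (min_le_left _ _)
        (le_max_left _ _) (min_le_left _ _) (le_max_left _ _),
      doubleCone_subset (hab := hab') (hcd := hce') (min_le_right _ _)
        (le_max_right _ _) (min_le_right _ _) (le_max_right _ _), ?_⟩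
    cases d
    · have h₁ := doubleCone_leftOf_iff (hab := hkl) (hcd := hmn) (hab' := hab) (hcd' := hce).1
        fun p hp q hq => h hq p hp
      have h₂ := doubleCone_leftOf_iff (hab := hkl) (hcd := hmn) (hab' := hab') (hcd' := hce').1
        fun p hp q hq => h' hq p hp
      exact fun p hp q hq => doubleCone_leftOf_iff (hab := hkl) (hcd := hmn).2
        ⟨le_min h₁.1 h₂.1, max_le h₁.2 h₂.2⟩ q hq p hp
    · have h₁ := doubleCone_leftOf_iff (hab := hab) (hcd := hce) (hab' := hkl) (hcd' := hmn).1
        fun p hp q hq => h hp q hq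
      have h₂ := doubleCone_leftOf_iff (hab := hab') (hcd := hce') (hab' := hkl) (hcd' := hmn).1
        fun p hp q hq => h' hp q hq
      exact fun p hp q hq => doubleCone_leftOf_iff (hab' := hkl) (hcd' := hmn).2
        ⟨max_le h₁.1 h₂.1, le_min h₁.2 h₂.2⟩ p hp q hq

theorem exists_onSide {s : Spacetime} (d : Bool) (O : Region s) : ∃ P, OnSide d P O := by
  obtain ⟨O, hO⟩ := O
  cases s with
  | lightRay =>
    obtain ⟨k, l, hkl, rfl⟩ := hO
    cases d
    · exact ⟨interval l (l + 1) (by linarith), fun p hp q hq =>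
        interval_leftOf_iff (hab := hkl).2 le_rfl q hq p hp⟩
    · exact ⟨interval (k - 1) k (by linarith), fun p hp q hq =>
        interval_leftOf_iff (hab' := hkl).2 le_rfl p hp q hq⟩
  | minkowski =>
    obtain ⟨k, l, m, n, hkl, hmn, rfl⟩ := hO
    cases d
    · exact ⟨doubleCone l (l + 1) (m - 1) m (by linarith) (by linarith), fun p hp q hq =>
        doubleCone_leftOf_iff (hab := hkl) (hcd := hmn).2 ⟨le_rfl, le_rfl⟩ q hq p hp⟩
    · exact ⟨doubleCone (k - 1) k n (n + 1) (by linarith) (by linarith), fun p hp q hq =>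
        doubleCone_leftOf_iff (hab' := hkl) (hcd' := hmn).2 ⟨le_rfl, le_rfl⟩ p hp q hq⟩

instance (s : Spacetime) : Nonempty (Region s) := ⟨(exists_left_region s).choose⟩

variable {s : Spacetime} {H : Type*} [NormedAddCommGroup H] [InnerProductSpace ℂ H]
  [CompleteSpace H] {A : Net s H}

/-! ### Local observables, transporters and intertwiners -/

namespace Net

theorem mem_quasi {O : Region s} {a : H →L[ℂ] H} (ha : a ∈ A.alg O) : a ∈ A.quasi :=
  StarSubalgebra.le_topologicalClosure _
    (le_iSup (fun O : Region s => (A.alg O).toStarSubalgebra) O ha)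

theorem commute_of_subset_causalCompl {O P : Region s} (h : P.1 ⊆ causalCompl O.1)
    {x c : A.quasi} (hx : (x : H →L[ℂ] H) ∈ A.alg O) (hc : (c : H →L[ℂ] H) ∈ A.alg P) :
    c * x = x * c := by
  have hx' : (x : H →L[ℂ] H) ∈ (A.alg O : Set (H →L[ℂ] H)) := hx
  rw [A.haag O] at hx'
  exact Subtype.ext (hx' _ (Set.mem_iUnion.2 ⟨⟨P, h⟩, hc⟩))

/-- Haag duality, for quasilocal observables. -/
theorem mem_alg_of_commute {O : Region s} {x : A.quasi}
    (h : ∀ P : Region s, P.1 ⊆ causalCompl O.1 → ∀ c : A.quasi, (c : H →L[ℂ] H) ∈ A.alg P →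
      c * x = x * c) : (x : H →L[ℂ] H) ∈ A.alg O := by
  have : (x : H →L[ℂ] H) ∈ (A.alg O : Set (H →L[ℂ] H)) := by
    rw [A.haag O]
    intro c hc
    obtain ⟨⟨P, hP⟩, hc⟩ := Set.mem_iUnion.1 hc
    exact congrArg Subtype.val (h P hP ⟨c, mem_quasi hc⟩ hc)
  exact this

theorem continuous_hom (ρ : A.quasi →⋆ₐ[ℂ] A.quasi) : Continuous ρ := by
  -- Closedness provides, by instance search, the C*-structure that makes *-homomorphisms
  -- contractive.
  have : IsClosed (A.quasi : Set (H →L[ℂ] H)) := StarSubalgebra.isClosed_topologicalClosure _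
  exact AddMonoidHomClass.continuous_of_bound ρ 1 fun a => by
    simpa using NonUnitalStarAlgHom.norm_apply_le ρ a

/-- Local observables are dense among the quasilocal ones. -/
theorem quasi_induction {p : A.quasi → Prop} (hp : IsClosed {a | p a})
    (h : ∀ (O : Region s) (a : A.quasi), (a : H →L[ℂ] H) ∈ A.alg O → p a) (a : A.quasi) : p a := by
  -- Directedness turns the supremum of the local algebras into a union, so the approximating
  -- elements are local.
  have hdir : Directed (· ≤ ·) fun O : Region s => (A.alg O).toStarSubalgebra := by
    intro O P
    obtain ⟨Q, hO, hP⟩ := exists_region_union O P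
    exact ⟨Q, A.isotone O Q hO, A.isotone P Q hP⟩
  have ha : (a : H →L[ℂ] H) ∈
      closure ((⨆ O : Region s, (A.alg O).toStarSubalgebra : StarSubalgebra ℂ (H →L[ℂ] H)) :
        Set (H →L[ℂ] H)) := a.2
  rw [StarSubalgebra.coe_iSup_of_directed hdir] at ha
  obtain ⟨u, hu, hlim⟩ := mem_closure_iff_seq_limit.1 ha
  have hmem : ∀ n, ∃ O : Region s, u n ∈ A.alg O := fun n => Set.mem_iUnion.1 (hu n)
  have hq : ∀ n, u n ∈ A.quasi := fun n => mem_quasi (hmem n).choose_spec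
  refine hp.mem_of_tendsto (f := fun n => (⟨u n, hq n⟩ : A.quasi)) (b := Filter.atTop) ?_
    (Filter.Eventually.of_forall fun n => ?_)
  · exact tendsto_subtype_rng.2 hlim
  · exact h _ _ (hmem n).choose_spec

namespace IsTransporter

variable {ρ σ : A.quasi →⋆ₐ[ℂ] A.quasi} {u v : A.quasi} {O P : Region s}

theorem star_mul_self (hu : A.IsTransporter ρ u O) : star u * u = 1 :=
  (Unitary.mem_iff.1 hu.1).1

theorem mul_star_self (hu : A.IsTransporter ρ u O) : u * star u = 1 :=
  (Unitary.mem_iff.1 hu.1).2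

theorem mul_map (hu : A.IsTransporter ρ u O) (h : P.1 ⊆ causalCompl O.1) {c : A.quasi}
    (hc : (c : H →L[ℂ] H) ∈ A.alg P) : u * ρ c = c * u := by
  conv_rhs => rw [← hu.2 P h c hc, mul_assoc _ _ u, hu.star_mul_self, mul_one]

theorem map_mul_star (hu : A.IsTransporter ρ u O) (h : P.1 ⊆ causalCompl O.1) {c : A.quasi}
    (hc : (c : H →L[ℂ] H) ∈ A.alg P) : ρ c * star u = star u * c := by
  conv_rhs => rw [← hu.2 P h c hc, mul_assoc u, ← mul_assoc (star u), hu.star_mul_self, one_mul]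

theorem comp (hu : A.IsTransporter ρ u O) (hv : A.IsTransporter σ v O) :
    A.IsTransporter (ρ.comp σ) (u * ρ v) O := by
  have hw : u * ρ v ∈ unitary A.quasi := by
    refine mul_mem hu.1 ?_
    rw [Unitary.mem_iff, ← map_star, ← map_mul, ← map_mul, hv.star_mul_self, hv.mul_star_self,
      map_one]
    exact ⟨rfl, rfl⟩
  refine ⟨hw, fun P h a ha => ?_⟩
  change u * ρ v * ρ (σ a) * star (u * ρ v) = a
  rw [mul_assoc u, ← map_mul, hv.mul_map h ha, map_mul, ← mul_assoc, hu.mul_map h ha, mul_assoc a,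
    mul_assoc a, (Unitary.mem_iff.1 hw).2, mul_one]

theorem one_id : A.IsTransporter (StarAlgHom.id ℂ A.quasi) 1 O :=
  ⟨one_mem _, fun _ _ a _ => by simp⟩

/-- Intertwiners become local observables after transport of charges. -/
theorem intertwiner_mem (hu : A.IsTransporter ρ u O) (hv : A.IsTransporter σ v O) {t : A.quasi}
    (ht : Intertwines ρ σ t) : ((v * t * star u : A.quasi) : H →L[ℂ] H) ∈ A.alg O := by
  refine mem_alg_of_commute fun P hP c hc => ?_
  calc c * (v * t * star u) = v * (σ c * t) * star u := by
        rw [← mul_assoc v, hv.mul_map hP hc]; simp only [mul_assoc]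
    _ = v * t * (ρ c * star u) := by rw [← ht]; simp only [mul_assoc]
    _ = v * t * star u * c := by rw [hu.map_mul_star hP hc]; simp only [mul_assoc]

theorem mono (hu : A.IsTransporter ρ u O) (h : O.1 ⊆ P.1) : A.IsTransporter ρ u P :=
  ⟨hu.1, fun _ hQ => hu.2 _ (hQ.trans (causalCompl_anti h))⟩

/-- Changes of charge transporters are local observables. -/
theorem mul_star_mem (hu : A.IsTransporter ρ u O) (hv : A.IsTransporter ρ v O) :
    ((v * star u : A.quasi) : H →L[ℂ] H) ∈ A.alg O := by
  simpa using hu.intertwiner_mem hv (t := 1) fun a => by simp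

/-- The endomorphism `Ad_u ∘ ρ` localized in `O` preserves the local algebra of `O`. -/
theorem conj_mem (hu : A.IsTransporter ρ u O) {a : A.quasi} (ha : (a : H →L[ℂ] H) ∈ A.alg O) :
    ((u * ρ a * star u : A.quasi) : H →L[ℂ] H) ∈ A.alg O := by
  refine mem_alg_of_commute fun P hP c hc => ?_
  calc c * (u * ρ a * star u) = u * ρ (c * a) * star u := by
        rw [map_mul, ← mul_assoc u, hu.mul_map hP hc]; simp only [mul_assoc]
    _ = u * ρ a * (ρ c * star u) := by
        rw [commute_of_subset_causalCompl hP ha hc, map_mul]; simp only [mul_assoc]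
    _ = u * ρ a * star u * c := by rw [hu.map_mul_star hP hc]; simp only [mul_assoc]

end IsTransporter

end Net

/-! ### The statistics operators -/

namespace Net.IsTransporter

variable {ρ σ : A.quasi →⋆ₐ[ℂ] A.quasi} {u u' v v' : A.quasi} {O O' P P' R : Region s}

theorem star_mul_cancel_left (hu : A.IsTransporter ρ u O) (a : A.quasi) : star u * (u * a) = a := by
  rw [← mul_assoc, hu.star_mul_self, one_mul]

theorem mul_star_cancel_left (hu : A.IsTransporter ρ u O) (a : A.quasi) : u * (star u * a) = a := by
  rw [← mul_assoc, hu.mul_star_self, one_mul]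

/-- The two transporters differ by z = u'u*, an observable in R. As R is spacelike to P, the charge
transported by v does not see it: σ(z)v* = v*z. -/
theorem statOp_congr_left (hu : A.IsTransporter ρ u O) (hu' : A.IsTransporter ρ u' O')
    (hv : A.IsTransporter σ v P) (hO : O.1 ⊆ R.1) (hO' : O'.1 ⊆ R.1) (hR : R.1 ⊆ causalCompl P.1) :
    σ (star u) * star v * u * ρ v = σ (star u') * star v * u' * ρ v := by
  have hz := (hu.mono hO).mul_star_mem (hu'.mono hO')
  calc σ (star u) * star v * u * ρ v
      = σ (star u' * (u' * star u)) * star v * u * ρ v := by rw [hu'.star_mul_cancel_left]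
    _ = σ (star u') * (σ (u' * star u) * star v) * u * ρ v := by rw [map_mul]; simp only [mul_assoc]
    _ = σ (star u') * star v * u' * (star u * (u * ρ v)) := by
        rw [hv.map_mul_star hR hz]; simp only [mul_assoc]
    _ = σ (star u') * star v * u' * ρ v := by rw [hu.star_mul_cancel_left]

/-- Mirror image of the previous argument: z = vv'* is an observable in R, and uρ(z) = zu. -/
theorem statOp_congr_right (hu : A.IsTransporter ρ u O) (hv : A.IsTransporter σ v P)
    (hv' : A.IsTransporter σ v' P') (hP : P.1 ⊆ R.1) (hP' : P'.1 ⊆ R.1)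
    (hR : R.1 ⊆ causalCompl O.1) :
    σ (star u) * star v * u * ρ v = σ (star u) * star v' * u * ρ v' := by
  have hz := (hv'.mono hP').mul_star_mem (hv.mono hP)
  calc σ (star u) * star v * u * ρ v
      = σ (star u) * star v * (u * ρ (v * star v')) * ρ v' := by
        rw [mul_assoc _ (u * _), mul_assoc u, ← map_mul, mul_assoc v, hv'.star_mul_self, mul_one]
        simp only [mul_assoc]
    _ = σ (star u) * (star v * (v * (star v' * (u * ρ v')))) := by
        rw [hu.mul_map hR hz]; simp only [mul_assoc]
    _ = σ (star u) * star v' * u * ρ v' := by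
        rw [hv.star_mul_cancel_left]; simp only [mul_assoc]

end Net.IsTransporter

/-- `e` is the statistics operator of `ρ` and `σ`, for charge transporters such that the one for
`σ` goes to the left (`d = true`), resp. to the right (`d = false`). -/
def IsBraid (d : Bool) (ρ σ : A.quasi →⋆ₐ[ℂ] A.quasi) (e : A.quasi) : Prop :=
  ∀ (O P : Region s) (u v : A.quasi), OnSide d P O → A.IsTransporter ρ u O →
    A.IsTransporter σ v P → e = σ (star u) * star v * u * ρ v

/-- The pair (O, P) is moved through (O, Q) and (O', Q) to (O', P'), where Q lies beyond a region
containing both O and O'. In each move one charge stays put and the other moves inside a single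
region on one side of it, so the value does not change. -/
theorem OnSide.isBraid {d : Bool} {ρ : A.quasi →⋆ₐ[ℂ] A.quasi} {σ : DHREndo A} {u v : A.quasi}
    {O P : Region s} (h : OnSide d P O) (hu : A.IsTransporter ρ u O)
    (hv : A.IsTransporter σ.toHom v P) :
    IsBraid d ρ σ.toHom (σ.toHom (star u) * star v * u * ρ v) := by
  intro O' P' u' v' h' hu' hv'
  obtain ⟨K, hOK, hOK'⟩ := exists_region_union O O'
  obtain ⟨Q, hQ⟩ := exists_onSide d K
  obtain ⟨w, hw⟩ := σ.transportable Q
  obtain ⟨R₁, h₁, h₁', hR₁⟩ := h.exists_union (hQ.mono hOK)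
  obtain ⟨R₂, h₂, h₂', hR₂⟩ := (hQ.mono hOK).symm.exists_union (hQ.mono hOK').symm
  obtain ⟨R₃, h₃, h₃', hR₃⟩ := (hQ.mono hOK').exists_union h'
  rw [hu.statOp_congr_right hv hw h₁ h₁' hR₁.subset_causalCompl,
    hu.statOp_congr_left hu' hw h₂ h₂' hR₂.subset_causalCompl,
    hu'.statOp_congr_right hw hv' h₃ h₃' hR₃.subset_causalCompl]

theorem braidPlus_isBraid (ρ σ : DHREndo A) :
    IsBraid true ρ.toHom σ.toHom (braidPlus ρ σ) := by
  obtain ⟨O, P, u, v, h, hu, hv, he⟩ := (exists_isStatOp ρ σ).choose_spec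
  change braidPlus ρ σ = _ at he
  rw [he]
  exact OnSide.isBraid (d := true) h hu hv

/-- The defining formula is carried to itself by the adjoint together with the exchange of the
charges, and the exchange reverses their relative position. -/
theorem IsBraid.adjoint {d : Bool} {ρ σ : A.quasi →⋆ₐ[ℂ] A.quasi} {e : A.quasi}
    (he : IsBraid d ρ σ e) : IsBraid (!d) σ ρ (star e) := by
  intro O P u v h hu hv
  have h' : OnSide d O P := by simpa using h.symm
  rw [he P O v u h' hv hu]
  simp only [star_mul, star_star, ← map_star, mul_assoc]

theorem braidMinus_isBraid (ρ σ : DHREndo A) :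
    IsBraid false ρ.toHom σ.toHom (braidMinus ρ σ) :=
  (braidPlus_isBraid σ ρ).adjoint

/-! ### Unitarity, naturality and hexagon identities of the braiding -/

namespace IsBraid

variable {d : Bool} {ρ σ : DHREndo A} {e : A.quasi}

theorem exists_transporters (K : Region s) (ρ σ : DHREndo A) (d : Bool) : ∃ (O P : Region s)
    (u v : A.quasi), OnSide (!d) O K ∧ OnSide d P K ∧ OnSide d P O ∧
      A.IsTransporter ρ.toHom u O ∧ A.IsTransporter σ.toHom v P := by
  obtain ⟨O, hO⟩ := exists_onSide (!d) K
  obtain ⟨K', hK, hK'⟩ := exists_region_union O K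
  obtain ⟨P, hP⟩ := exists_onSide d K'
  obtain ⟨u, hu⟩ := ρ.transportable O
  obtain ⟨v, hv⟩ := σ.transportable P
  exact ⟨O, P, u, v, hO, hP.mono hK', hP.mono hK, hu, hv⟩

theorem star_mul_self (he : IsBraid d ρ.toHom σ.toHom e) : star e * e = 1 := by
  obtain ⟨O, P, u, v, -, -, h, hu, hv⟩ := exists_transporters (Classical.arbitrary _) ρ σ d
  rw [he O P u v h hu hv]
  simp only [star_mul, star_star, ← map_star, mul_assoc]
  rw [← mul_assoc (σ.toHom u), ← map_mul, hu.mul_star_self, map_one, one_mul,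
    hv.mul_star_cancel_left, hu.star_mul_cancel_left, ← map_mul, hv.star_mul_self, map_one]

theorem mul_star_self (he : IsBraid d ρ.toHom σ.toHom e) : e * star e = 1 := by
  simpa using he.adjoint.star_mul_self

/-- The statistics operators intertwine `ρσ` and `σρ`. -/
theorem intertwines (he : IsBraid d ρ.toHom σ.toHom e) :
    Intertwines (ρ.comp σ).toHom (σ.comp ρ).toHom e := by
  intro a
  refine Net.quasi_induction
    (p := fun a => e * (ρ.comp σ).toHom a = (σ.comp ρ).toHom a * e) ?_ ?_ a
  · exact isClosed_eq (continuous_const.mul (Net.continuous_hom _))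
      ((Net.continuous_hom _).mul continuous_const)
  intro K a ha
  -- Both charges are sent away from K, to opposite sides, so that `a` passes through all four
  -- transporters in turn.
  obtain ⟨O, P, u, v, hO, hP, h, hu, hv⟩ := exists_transporters K ρ σ d
  have hKO : K.1 ⊆ causalCompl O.1 := by simpa using hO.symm.subset_causalCompl
  have hKP : K.1 ⊆ causalCompl P.1 := hP.symm.subset_causalCompl
  rw [he O P u v h hu hv]
  change _ * ρ.toHom (σ.toHom a) = σ.toHom (ρ.toHom a) * _
  calc σ.toHom (star u) * star v * u * ρ.toHom v * ρ.toHom (σ.toHom a)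
      = σ.toHom (star u) * star v * (u * ρ.toHom (v * σ.toHom a)) := by
        simp only [map_mul, mul_assoc]
    _ = σ.toHom (star u) * star v * (u * ρ.toHom a) * ρ.toHom v := by
        rw [hv.mul_map hKP ha]; simp only [map_mul, mul_assoc]
    _ = σ.toHom (star u) * (star v * a) * u * ρ.toHom v := by
        rw [hu.mul_map hKO ha]; simp only [mul_assoc]
    _ = σ.toHom (star u * a) * star v * u * ρ.toHom v := by
        rw [← hv.map_mul_star hKP ha, map_mul]; simp only [mul_assoc]
    _ = σ.toHom (ρ.toHom a) * (σ.toHom (star u) * star v * u * ρ.toHom v) := by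
        rw [← hu.map_mul_star hKO ha, map_mul]; simp only [mul_assoc]

theorem mul_map_map (he : IsBraid d ρ.toHom σ.toHom e) (a : A.quasi) :
    e * ρ.toHom (σ.toHom a) = σ.toHom (ρ.toHom a) * e :=
  he.intertwines a

/-- Naturality of the braiding for intertwiners `id → ρ`. -/
theorem mul_of_intertwines_id (he : IsBraid d ρ.toHom σ.toHom e) {w : A.quasi}
    (hw : Intertwines (StarAlgHom.id ℂ A.quasi) ρ.toHom w) : e * w = σ.toHom w := by
  obtain ⟨O, P, u, v, -, -, h, hu, hv⟩ := exists_transporters (Classical.arbitrary _) ρ σ d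
  -- The identity is transported to O by 1, so the transported intertwiner is `u * w`; it is local
  -- in O and invisible to the charge in P.
  have hmem : ((u * w : A.quasi) : H →L[ℂ] H) ∈ A.alg O := by
    simpa using Net.IsTransporter.one_id.intertwiner_mem hu hw
  have hw' : w * v = ρ.toHom v * w := hw v
  have hOP : O.1 ⊆ causalCompl P.1 := h.symm.subset_causalCompl
  rw [he O P u v h hu hv]
  calc σ.toHom (star u) * star v * u * ρ.toHom v * w
      = σ.toHom (star u) * (star v * (u * w)) * v := by
        rw [mul_assoc _ _ w, ← hw']; simp only [mul_assoc]
    _ = σ.toHom (star u * (u * w)) * (star v * v) := by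
        rw [← hv.map_mul_star hOP hmem, map_mul _ (star u)]; simp only [mul_assoc]
    _ = σ.toHom w := by rw [hu.star_mul_cancel_left, hv.star_mul_self, mul_one]

theorem map_star_mul_of_intertwines_id (he : IsBraid d ρ.toHom σ.toHom e) {w : A.quasi}
    (hw : Intertwines (StarAlgHom.id ℂ A.quasi) ρ.toHom w) : σ.toHom (star w) * e = star w := by
  rw [map_star, ← he.mul_of_intertwines_id hw, star_mul, mul_assoc, he.star_mul_self, mul_one]

/-- The hexagon identity, combined with the naturality for `x : σ → σ²`. -/
theorem hexagon (he : IsBraid d ρ.toHom σ.toHom e) {x : A.quasi}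
    (hx : Intertwines σ.toHom (σ.comp σ).toHom x) :
    x * e = σ.toHom e * e * ρ.toHom x := by
  obtain ⟨O, P, u, v, -, -, h, hu, hv⟩ := exists_transporters (Classical.arbitrary _) ρ σ d
  have hPO : P.1 ⊆ causalCompl O.1 := h.subset_causalCompl
  have hmem : ((v * σ.toHom v * x * star v : A.quasi) : H →L[ℂ] H) ∈ A.alg P :=
    hv.intertwiner_mem (hv.comp hv) hx
  have hx' : ∀ a, x * σ.toHom a = σ.toHom (σ.toHom a) * x := hx
  -- This is the statistics operator of ρ and σ² formed with the transporter vσ(v) of σ². What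
  -- remains is naturality for x, whose transported form is local in P.
  have hee : σ.toHom e * e = σ.toHom (σ.toHom (star u)) * σ.toHom (star v) * star v * u *
      ρ.toHom (v * σ.toHom v) := by
    calc σ.toHom e * e
        = σ.toHom (σ.toHom (star u)) * σ.toHom (star v) * σ.toHom u * (σ.toHom (ρ.toHom v) * e) := by
          nth_rw 1 [he O P u v h hu hv]
          simp only [map_mul, mul_assoc]
      _ = σ.toHom (σ.toHom (star u)) * σ.toHom (star v) * σ.toHom u * (e * ρ.toHom (σ.toHom v)) := by
          rw [he.mul_map_map]
      _ = σ.toHom (σ.toHom (star u)) * σ.toHom (star v) * σ.toHom (u * star u) * star v * u *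
            ρ.toHom v * ρ.toHom (σ.toHom v) := by
          rw [he O P u v h hu hv]
          simp only [map_mul, mul_assoc]
      _ = _ := by
          rw [hu.mul_star_self, map_one, mul_one, map_mul]
          simp only [mul_assoc]
  calc x * e = x * σ.toHom (star u) * star v * u * ρ.toHom v := by
        rw [he O P u v h hu hv]; simp only [mul_assoc]
    _ = σ.toHom (σ.toHom (star u)) * x * star v * u * ρ.toHom v := by rw [hx']
    _ = σ.toHom (σ.toHom (star u)) * (σ.toHom (star v) *
          (star v * (v * (σ.toHom v * (x * (star v * (u * ρ.toHom v))))))) := by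
        rw [hv.star_mul_cancel_left, ← mul_assoc (σ.toHom (star v)), ← map_mul, hv.star_mul_self,
          map_one, one_mul]
        simp only [mul_assoc]
    _ = σ.toHom (σ.toHom (star u)) * σ.toHom (star v) * star v *
          (u * ρ.toHom (v * σ.toHom v * x * star v)) * ρ.toHom v := by
        rw [hu.mul_map hPO hmem]; simp only [mul_assoc]
    _ = σ.toHom (σ.toHom (star u)) * σ.toHom (star v) * star v * u *
          ρ.toHom (v * σ.toHom v * (x * (star v * v))) := by
        simp only [map_mul, mul_assoc]
    _ = σ.toHom e * e * ρ.toHom x := by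
        rw [hv.star_mul_self, mul_one, hee, map_mul _ _ x]; simp only [mul_assoc]

/-- The other hexagon identity, combined with the naturality for `x : ρ → ρ²`. -/
theorem hexagon' (he : IsBraid d ρ.toHom σ.toHom e) {x : A.quasi}
    (hx : Intertwines ρ.toHom (ρ.comp ρ).toHom x) :
    σ.toHom x * e = e * ρ.toHom e * x := by
  -- The first hexagon applied to the opposite braiding e* with the charges exchanged; unitarity of
  -- e then moves e* across.
  have h := he.adjoint.hexagon hx
  calc σ.toHom x * e = e * (ρ.toHom (e * star e)) * (star e * σ.toHom x) * e := by
        rw [he.mul_star_self, map_one, mul_one, ← mul_assoc, he.mul_star_self, one_mul]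
    _ = e * ρ.toHom e * (ρ.toHom (star e) * star e * σ.toHom x) * e := by
        rw [map_mul]; simp only [mul_assoc]
    _ = e * ρ.toHom e * x := by
        rw [← h, mul_assoc, mul_assoc x, he.star_mul_self, mul_one]

end IsBraid

/-! ### Charged fields -/

/-- The generator of an extension, in its vacuum representation, satisfies `v* = ι(w* x*) v`. -/
theorem Triple.IsQSystem.star_x {T : Triple A} (h : T.IsQSystem) :
    star T.x = T.θ.toHom (star T.w * star T.x) * T.x := by
  rw [map_mul, mul_assoc, ← h.frobenius, ← mul_assoc, h.unit_right, one_mul]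

theorem Triple.IsQSystem.x_mul_map {T : Triple A} (h : T.IsQSystem) (a : A.quasi) :
    T.x * T.θ.toHom a = T.θ.toHom (T.θ.toHom a) * T.x :=
  h.x_hom a

theorem Triple.IsQSystem.w_mul {T : Triple A} (h : T.IsQSystem) (a : A.quasi) :
    T.w * a = T.θ.toHom a * T.w :=
  h.w_hom a

theorem Triple.IsQSystem.star_w_mul_map {T : Triple A} (h : T.IsQSystem) (a : A.quasi) :
    star T.w * T.θ.toHom a = a * star T.w := by
  simpa [← map_star] using congrArg star (h.w_mul (star a)).symm

section Charged

variable {κ : A.quasi →⋆ₐ[ℂ] A.quasi} {V : A.quasi}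

/-- Charged fields commute with the observables of the causal complement. -/
theorem commute_charged_observable {θ : A.quasi →⋆ₐ[ℂ] A.quasi}
    (hV : ∀ a, V * κ a = κ (θ a) * V) {O P : Region s} (h : P.1 ⊆ causalCompl O.1)
    {u c : A.quasi} (hu : A.IsTransporter θ u O) (hc : (c : H →L[ℂ] H) ∈ A.alg P) :
    Commute (κ u * V) (κ c) := by
  rw [commute_iff_eq, mul_assoc, hV, ← mul_assoc, ← map_mul, hu.mul_map h hc, map_mul, mul_assoc]

theorem commute_observables {O P : Region s} (h : P.1 ⊆ causalCompl O.1) {a c : A.quasi}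
    (ha : (a : H →L[ℂ] H) ∈ A.alg O) (hc : (c : H →L[ℂ] H) ∈ A.alg P) :
    Commute (κ a) (κ c) := by
  rw [commute_iff_eq, ← map_mul, ← map_mul, Net.commute_of_subset_causalCompl h ha hc]

/-- The adjoints of charged fields are charged fields. -/
theorem exists_star_charged {T : Triple A} (hT : T.IsQSystem)
    (hV : ∀ a, V * κ a = κ (T.θ.toHom a) * V) (hV' : star V = κ (star T.w * star T.x) * V)
    {O : Region s} {a u : A.quasi} (ha : (a : H →L[ℂ] H) ∈ A.alg O)
    (hu : A.IsTransporter T.θ.toHom u O) :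
    ∃ a' : A.quasi, (a' : H →L[ℂ] H) ∈ A.alg O ∧
      star (κ a * (κ u * V)) = κ a' * (κ u * V) := by
  have hw : ((u * T.w : A.quasi) : H →L[ℂ] H) ∈ A.alg O := by
    simpa using Net.IsTransporter.one_id.intertwiner_mem hu hT.w_hom
  have hx : ((u * T.θ.toHom u * T.x * star u : A.quasi) : H →L[ℂ] H) ∈ A.alg O :=
    hu.intertwiner_mem (hu.comp hu) hT.x_hom
  have ha' : ((u * T.θ.toHom (star a) * star u : A.quasi) : H →L[ℂ] H) ∈ A.alg O :=
    hu.conj_mem (star_mem ha)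
  -- All three factors are local in O by construction. The inner transporters cancel, leaving
  -- w*x*θ(u*a*)u*, and the final u* cancels against the u of the charged field.
  refine ⟨star (u * T.w) * star (u * T.θ.toHom u * T.x * star u) *
    (u * T.θ.toHom (star a) * star u), mul_mem (mul_mem (star_mem hw) (star_mem hx)) ha', ?_⟩
  calc star (κ a * (κ u * V)) = star V * κ (star u * star a) := by
        simp only [star_mul, ← map_star, map_mul, mul_assoc]
    _ = κ (star T.w * star T.x * T.θ.toHom (star u) * T.θ.toHom (star a)) * V := by
        rw [hV', mul_assoc, hV]; simp only [map_mul, mul_assoc]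
    _ = _ := by
        rw [← mul_assoc, ← map_mul]
        congr 2
        simp only [star_mul, star_star, ← map_star, mul_assoc, hu.star_mul_cancel_left,
          hu.star_mul_self, mul_one]

end Charged

/-! ### The two factors of a braided product -/

section Product

variable {T₁ T₂ : Triple A} {d : Bool} {e : A.quasi}

/-- The generator `v₁` of the first factor is `θ₁(e) x₁`. -/
theorem fst_generator (h₁ : T₁.IsQSystem) (h₂ : T₂.IsQSystem)
    (he : IsBraid d T₁.θ.toHom T₂.θ.toHom e) :
    (T₁.θ.comp T₂.θ).toHom (T₁.θ.toHom (star T₂.w)) * (T₁.prodWith T₂ e).x =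
      T₁.θ.toHom e * T₁.x := by
  change T₁.θ.toHom (T₂.θ.toHom (T₁.θ.toHom (star T₂.w))) *
    (T₁.θ.toHom e * T₁.x * T₁.θ.toHom T₂.x) = _
  rw [← mul_assoc, ← mul_assoc, ← map_mul, ← he.mul_map_map, map_mul, mul_assoc _ _ T₁.x,
    ← h₁.x_mul_map, mul_assoc, mul_assoc T₁.x, ← map_mul, h₂.unit_right, map_one, mul_one]

/-- The generator `v₂` of the second factor is `θ₁(x₂)`. -/
theorem snd_generator (h₁ : T₁.IsQSystem) (he : IsBraid d T₁.θ.toHom T₂.θ.toHom e) :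
    (T₁.θ.comp T₂.θ).toHom (star T₁.w) * (T₁.prodWith T₂ e).x = T₁.θ.toHom T₂.x := by
  change T₁.θ.toHom (T₂.θ.toHom (star T₁.w)) * (T₁.θ.toHom e * T₁.x * T₁.θ.toHom T₂.x) = _
  rw [← mul_assoc, ← mul_assoc, ← map_mul, he.map_star_mul_of_intertwines_id h₁.w_hom,
    h₁.unit_right, one_mul]

/-- Moving x₁ past θ₁(θ₂(a)) gives θ₁²θ₂ in front; the braiding reorders it to θ₁θ₂θ₁. -/
theorem fst_mul_map (h₁ : T₁.IsQSystem) (he : IsBraid d T₁.θ.toHom T₂.θ.toHom e) (a : A.quasi) :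
    T₁.θ.toHom e * T₁.x * (T₁.θ.comp T₂.θ).toHom a =
      (T₁.θ.comp T₂.θ).toHom (T₁.θ.toHom a) * (T₁.θ.toHom e * T₁.x) := by
  change T₁.θ.toHom e * T₁.x * T₁.θ.toHom (T₂.θ.toHom a) =
    T₁.θ.toHom (T₂.θ.toHom (T₁.θ.toHom a)) * (T₁.θ.toHom e * T₁.x)
  rw [mul_assoc, h₁.x_mul_map, ← mul_assoc, ← map_mul, he.mul_map_map, map_mul, mul_assoc]

theorem snd_mul_map (h₂ : T₂.IsQSystem) (a : A.quasi) :
    T₁.θ.toHom T₂.x * (T₁.θ.comp T₂.θ).toHom a =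
      (T₁.θ.comp T₂.θ).toHom (T₂.θ.toHom a) * T₁.θ.toHom T₂.x := by
  change T₁.θ.toHom T₂.x * T₁.θ.toHom (T₂.θ.toHom a) =
    T₁.θ.toHom (T₂.θ.toHom (T₂.θ.toHom a)) * T₁.θ.toHom T₂.x
  rw [← map_mul, h₂.x_mul_map, map_mul]

theorem star_snd (h₂ : T₂.IsQSystem) :
    star (T₁.θ.toHom T₂.x) =
      (T₁.θ.comp T₂.θ).toHom (star T₂.w * star T₂.x) * T₁.θ.toHom T₂.x := by
  change _ = T₁.θ.toHom (T₂.θ.toHom (star T₂.w * star T₂.x)) * T₁.θ.toHom T₂.x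
  rw [← map_star]
  conv_lhs => rw [h₂.star_x, map_mul]

/-- Unlike v₂, the generator v₁ is not simply a θ₁-image of its counterpart, so the relation for x₁
cannot be transferred by applying θ₁. The adjoint of `hexagon'` carries x₁* through e, and w₁*
absorbs the braiding. -/
theorem star_fst (h₁ : T₁.IsQSystem) (he : IsBraid d T₁.θ.toHom T₂.θ.toHom e) :
    star (T₁.θ.toHom e * T₁.x) =
      (T₁.θ.comp T₂.θ).toHom (star T₁.w * star T₁.x) * (T₁.θ.toHom e * T₁.x) := by
  have h : T₂.θ.toHom (star T₁.x) * e = e * (star T₁.x * T₁.θ.toHom (star e)) := by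
    have h' := congrArg star (he.hexagon' h₁.x_hom)
    simp only [star_mul, ← map_star] at h'
    calc T₂.θ.toHom (star T₁.x) * e
        = e * (star e * T₂.θ.toHom (star T₁.x)) * e := by
          rw [← mul_assoc, he.mul_star_self, one_mul]
      _ = e * (star T₁.x * T₁.θ.toHom (star e)) * (star e * e) := by
          rw [h']; simp only [mul_assoc]
      _ = _ := by rw [he.star_mul_self, mul_one]
  change _ = T₁.θ.toHom (T₂.θ.toHom (star T₁.w * star T₁.x)) * (T₁.θ.toHom e * T₁.x)
  calc star (T₁.θ.toHom e * T₁.x) = star T₁.x * T₁.θ.toHom (star e) := by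
        rw [star_mul, map_star]
    _ = T₁.θ.toHom (star T₁.w * star T₁.x * T₁.θ.toHom (star e)) * T₁.x := by
        nth_rw 1 [h₁.star_x]
        rw [mul_assoc, h₁.x_mul_map, ← mul_assoc, ← map_mul]
    _ = T₁.θ.toHom (T₂.θ.toHom (star T₁.w) * e * (star T₁.x * T₁.θ.toHom (star e))) * T₁.x := by
        rw [he.map_star_mul_of_intertwines_id h₁.w_hom, mul_assoc]
    _ = _ := by
        rw [mul_assoc _ e, ← h]
        simp only [map_mul, mul_assoc]

/-- The hexagon for x₂ produces the exchange relation v₂v₁ = ι(e)v₁v₂. -/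
theorem snd_mul_fst (he : IsBraid d T₁.θ.toHom T₂.θ.toHom e) (h₁ : T₁.IsQSystem)
    (h₂ : T₂.IsQSystem) :
    T₁.θ.toHom T₂.x * (T₁.θ.toHom e * T₁.x) =
      (T₁.θ.comp T₂.θ).toHom e * (T₁.θ.toHom e * T₁.x * T₁.θ.toHom T₂.x) := by
  change _ = T₁.θ.toHom (T₂.θ.toHom e) * (T₁.θ.toHom e * T₁.x * T₁.θ.toHom T₂.x)
  rw [← mul_assoc, ← map_mul, he.hexagon h₂.x_hom, mul_assoc _ T₁.x, h₁.x_mul_map]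
  simp only [map_mul, mul_assoc]

theorem fst_mul_fst (he : IsBraid d T₁.θ.toHom T₂.θ.toHom e) (h₁ : T₁.IsQSystem) :
    T₁.θ.toHom e * T₁.x * (T₁.θ.toHom e * T₁.x) =
      (T₁.θ.comp T₂.θ).toHom T₁.x * (T₁.θ.toHom e * T₁.x) := by
  change _ = T₁.θ.toHom (T₂.θ.toHom T₁.x) * (T₁.θ.toHom e * T₁.x)
  calc T₁.θ.toHom e * T₁.x * (T₁.θ.toHom e * T₁.x)
      = T₁.θ.toHom e * (T₁.x * T₁.θ.toHom e) * T₁.x := by simp only [mul_assoc]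
    _ = T₁.θ.toHom e * T₁.θ.toHom (T₁.θ.toHom e) * (T₁.x * T₁.x) := by
        rw [h₁.x_mul_map]; simp only [mul_assoc]
    _ = T₁.θ.toHom (e * T₁.θ.toHom e * T₁.x) * T₁.x := by
        rw [h₁.assoc]; simp only [map_mul, mul_assoc]
    _ = _ := by rw [← he.hexagon' h₁.x_hom, map_mul, mul_assoc]

/-! ### Commutation of charged fields -/

/-- Charged fields of the two factors commute if those of the second factor are on the side
determined by the braiding. -/
theorem commute_fst_snd (he : IsBraid d T₁.θ.toHom T₂.θ.toHom e) (h₁ : T₁.IsQSystem)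
    (h₂ : T₂.IsQSystem) {O P : Region s} (h : OnSide d P O) {u v : A.quasi}
    (hu : A.IsTransporter T₁.θ.toHom u O) (hv : A.IsTransporter T₂.θ.toHom v P) :
    Commute ((T₁.θ.comp T₂.θ).toHom u * (T₁.θ.toHom e * T₁.x))
      ((T₁.θ.comp T₂.θ).toHom v * T₁.θ.toHom T₂.x) := by
  -- With e expressed through the transporters of the two fields themselves, its factors cancel the
  -- mismatch between the two orders of transport.
  have key : v * T₂.θ.toHom u * e = u * T₁.θ.toHom v := by
    rw [he O P u v h hu hv]
    calc _ = v * T₂.θ.toHom (u * star u) * (star v * (u * T₁.θ.toHom v)) := by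
          simp only [map_mul, mul_assoc]
      _ = _ := by rw [hu.mul_star_self, map_one, mul_one, hv.mul_star_cancel_left]
  set κ := (T₁.θ.comp T₂.θ).toHom with hκ
  rw [commute_iff_eq]
  calc κ u * (T₁.θ.toHom e * T₁.x) * (κ v * T₁.θ.toHom T₂.x)
      = κ u * (T₁.θ.toHom e * T₁.x * κ v) * T₁.θ.toHom T₂.x := by simp only [mul_assoc]
    _ = κ (u * T₁.θ.toHom v) * (T₁.θ.toHom e * T₁.x * T₁.θ.toHom T₂.x) := by
        rw [hκ, fst_mul_map h₁ he]; simp only [map_mul, mul_assoc]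
    _ = κ v * κ (T₂.θ.toHom u) * (κ e * (T₁.θ.toHom e * T₁.x * T₁.θ.toHom T₂.x)) := by
        rw [← key]; simp only [map_mul, mul_assoc]
    _ = κ v * (κ (T₂.θ.toHom u) * T₁.θ.toHom T₂.x) * (T₁.θ.toHom e * T₁.x) := by
        rw [hκ, ← snd_mul_fst he h₁ h₂]; simp only [mul_assoc]
    _ = _ := by rw [hκ, ← snd_mul_map h₂]; simp only [mul_assoc]

theorem charged_mem_ext {T : Triple A} {O : Region s} {u : A.quasi}
    (hu : A.IsTransporter T.θ.toHom u O) :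
    ((T.θ.toHom u * T.x : A.quasi) : H →L[ℂ] H) ∈ T.ext O :=
  ⟨1, u, one_mem (A.alg O), hu, by rw [map_one, one_mul]; rfl⟩

theorem IsLocalNet.commute_charged {T : Triple A} (hT : IsLocalNet T.ext) {O P : Region s}
    (h : P.1 ⊆ causalCompl O.1) {u v : A.quasi} (hu : A.IsTransporter T.θ.toHom u O)
    (hv : A.IsTransporter T.θ.toHom v P) :
    Commute (T.θ.toHom u * T.x) (T.θ.toHom v * T.x) :=
  Subtype.ext (hT P O h _ (charged_mem_ext hv) _ (charged_mem_ext hu)).symm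

/-- The fields of the second factor are the θ₁-images of those of B₂ in its vacuum representation,
so locality is transferred by θ₁. -/
theorem commute_snd_snd (hT : IsLocalNet T₂.ext) {O P : Region s}
    (h : P.1 ⊆ causalCompl O.1) {u v : A.quasi} (hu : A.IsTransporter T₂.θ.toHom u O)
    (hv : A.IsTransporter T₂.θ.toHom v P) :
    Commute ((T₁.θ.comp T₂.θ).toHom u * T₁.θ.toHom T₂.x)
      ((T₁.θ.comp T₂.θ).toHom v * T₁.θ.toHom T₂.x) := by
  have := (hT.commute_charged h hu hv).map T₁.θ.toHom
  rwa [map_mul, map_mul] at this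

/-- Locality of B₁ is first turned into the identity uθ₁(v)x₁ = vθ₁(u)x₁ between coefficients.
Products of v₁-fields obey the same multiplication rule, so this identity gives their commutativity.
-/
theorem commute_fst_fst (hT : IsLocalNet T₁.ext) (h₁ : T₁.IsQSystem)
    (he : IsBraid d T₁.θ.toHom T₂.θ.toHom e) {O P : Region s}
    (h : P.1 ⊆ causalCompl O.1) {u v : A.quasi} (hu : A.IsTransporter T₁.θ.toHom u O)
    (hv : A.IsTransporter T₁.θ.toHom v P) :
    Commute ((T₁.θ.comp T₂.θ).toHom u * (T₁.θ.toHom e * T₁.x))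
      ((T₁.θ.comp T₂.θ).toHom v * (T₁.θ.toHom e * T₁.x)) := by
  have hprod : ∀ a b : A.quasi, T₁.θ.toHom a * T₁.x * (T₁.θ.toHom b * T₁.x) =
      T₁.θ.toHom (a * T₁.θ.toHom b * T₁.x) * T₁.x := by
    intro a b
    calc _ = T₁.θ.toHom a * (T₁.x * T₁.θ.toHom b) * T₁.x := by simp only [mul_assoc]
      _ = T₁.θ.toHom a * T₁.θ.toHom (T₁.θ.toHom b) * (T₁.x * T₁.x) := by
          rw [h₁.x_mul_map]; simp only [mul_assoc]
      _ = _ := by rw [h₁.assoc]; simp only [map_mul, mul_assoc]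
  -- The vacuum representation is faithful: w₁* recovers the coefficient.
  have hinj : ∀ a : A.quasi, star T₁.w * (T₁.θ.toHom a * T₁.x) = a := by
    intro a
    rw [← mul_assoc, h₁.star_w_mul_map, mul_assoc, h₁.unit_left, mul_one]
  have key : u * T₁.θ.toHom v * T₁.x = v * T₁.θ.toHom u * T₁.x := by
    have := (hT.commute_charged h hu hv).eq
    rw [hprod, hprod] at this
    rw [← hinj (u * _ * _), this, hinj]
  have hprod' : ∀ a b : A.quasi,
      (T₁.θ.comp T₂.θ).toHom a * (T₁.θ.toHom e * T₁.x) *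
        ((T₁.θ.comp T₂.θ).toHom b * (T₁.θ.toHom e * T₁.x)) =
      (T₁.θ.comp T₂.θ).toHom (a * T₁.θ.toHom b * T₁.x) * (T₁.θ.toHom e * T₁.x) := by
    intro a b
    set κ := (T₁.θ.comp T₂.θ).toHom with hκ
    calc _ = κ a * (T₁.θ.toHom e * T₁.x * κ b) * (T₁.θ.toHom e * T₁.x) := by
          simp only [mul_assoc]
      _ = κ a * κ (T₁.θ.toHom b) * (T₁.θ.toHom e * T₁.x * (T₁.θ.toHom e * T₁.x)) := by
          rw [hκ, fst_mul_map h₁ he]; simp only [mul_assoc]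
      _ = _ := by rw [fst_mul_fst he h₁, ← hκ]; simp only [map_mul, mul_assoc]
  rw [commute_iff_eq, hprod', hprod', key]

end Product

/-! ### Inclusions in the left and right centres -/

/-- The left (`d = true`), resp. right (`d = false`), centre of a net. -/
def sideCentre (d : Bool) (B : Region s → Set (H →L[ℂ] H)) (O : Region s) : Set (H →L[ℂ] H) :=
  Set.centralizer (genAlg B (sideWedge d O)) ∩ genAlg B (causalCompl (sideWedge (!d) O))

/-- The triple commutant is the commutant, so only generators matter. These include adjoints, which
is why both b and b* must commute with the fields. -/
theorem mem_sideCentre {d : Bool} {B : Region s → Set (H →L[ℂ] H)} {O : Region s}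
    {b : H →L[ℂ] H} (hb : b ∈ B O)
    (h : ∀ P : Region s, OnSide d P O → ∀ c ∈ B P, Commute b c ∧ Commute (star b) c) :
    b ∈ sideCentre d B O := by
  constructor
  · rw [genAlg, Set.centralizer_centralizer_centralizer]
    rintro c ⟨P, hP, hc | hc⟩
    · exact (h P hP c hc).1.symm.eq
    · simpa using (h P hP _ hc).2.star_star.symm.eq
  · exact Set.subset_centralizer_centralizer
      ⟨O, subset_causalCompl_sideWedge _ _, Or.inl hb⟩

section Product

variable {T₁ T₂ : Triple A} {d : Bool} {e : A.quasi}

/-- An observable commutes with `C(O)`, `C` being a braided product, as soon as it commutes with the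
observables in `O` and with the charged fields of both factors. -/
theorem commute_ext_prodWith (h₁ : T₁.IsQSystem) (he : IsBraid d T₁.θ.toHom T₂.θ.toHom e)
    {O : Region s} {b : A.quasi}
    (h : ∀ c : A.quasi, (c : H →L[ℂ] H) ∈ A.alg O → Commute b ((T₁.θ.comp T₂.θ).toHom c))
    (hfst : ∀ u, A.IsTransporter T₁.θ.toHom u O →
      Commute b ((T₁.θ.comp T₂.θ).toHom u * (T₁.θ.toHom e * T₁.x)))
    (hsnd : ∀ u, A.IsTransporter T₂.θ.toHom u O →
      Commute b ((T₁.θ.comp T₂.θ).toHom u * T₁.θ.toHom T₂.x))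
    {c : H →L[ℂ] H} (hc : c ∈ (T₁.prodWith T₂ e).ext O) : Commute (b : H →L[ℂ] H) c := by
  obtain ⟨a, u, ha, hu, rfl⟩ := hc
  obtain ⟨u₁, hu₁⟩ := T₁.θ.transportable O
  obtain ⟨u₂, hu₂⟩ := T₂.θ.transportable O
  have hu₁₂ := hu₁.comp hu₂
  have hz := hu₁₂.mul_star_mem hu
  set κ := (T₁.θ.comp T₂.θ).toHom with hκ
  -- Replacing u by the product transporter u₁θ₁(u₂) costs an observable in O; then v = v₁v₂ splits
  -- the field into one field of each factor.
  have key : κ u * (T₁.θ.toHom e * T₁.x * T₁.θ.toHom T₂.x) =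
      κ (u * star (u₁ * T₁.θ.toHom u₂)) *
        ((κ u₁ * (T₁.θ.toHom e * T₁.x)) * (κ u₂ * T₁.θ.toHom T₂.x)) := by
    calc κ u * (T₁.θ.toHom e * T₁.x * T₁.θ.toHom T₂.x)
        = κ (u * star (u₁ * T₁.θ.toHom u₂)) * (κ u₁ * (κ (T₁.θ.toHom u₂) *
            (T₁.θ.toHom e * T₁.x)) * T₁.θ.toHom T₂.x) := by
          simp only [← mul_assoc, ← map_mul]
          rw [mul_assoc _ u₁, mul_assoc u, hu₁₂.star_mul_self, mul_one]
      _ = _ := by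
          rw [hκ, ← fst_mul_map h₁ he]; simp only [mul_assoc]
  have hcomm : Commute b (κ a * (κ u * (T₁.θ.toHom e * T₁.x * T₁.θ.toHom T₂.x))) := by
    rw [key]
    exact (h a ha).mul_right ((h _ hz).mul_right ((hfst u₁ hu₁).mul_right (hsnd u₂ hu₂)))
  exact congrArg Subtype.val hcomm.eq

/-- If the second factor is local, it is contained in the centre of the braided product on the
side opposite to the one determined by the braiding. -/
theorem sndIn_subset_sideCentre (h₁ : T₁.IsQSystem) (h₂ : T₂.IsQSystem)
    (he : IsBraid d T₁.θ.toHom T₂.θ.toHom e) (hloc : IsLocalNet T₂.ext) (O : Region s) :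
    T₁.sndIn T₂ (T₁.prodWith T₂ e) O ⊆ sideCentre (!d) (T₁.prodWith T₂ e).ext O := by
  rintro b ⟨a, u, ha, hu, rfl⟩
  -- The coefficient `a` is left arbitrary because the adjoint of the field has the same form with
  -- another coefficient.
  have hcomm : ∀ P : Region s, OnSide (!d) P O → ∀ c ∈ (T₁.prodWith T₂ e).ext P,
      ∀ a : A.quasi, (a : H →L[ℂ] H) ∈ A.alg O →
        Commute (((T₁.θ.comp T₂.θ).toHom a * ((T₁.θ.comp T₂.θ).toHom u * T₁.θ.toHom T₂.x) :
          A.quasi) : H →L[ℂ] H) c := by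
    intro P hP c hc a ha
    have hPO := hP.subset_causalCompl
    have hOP := hP.symm.subset_causalCompl
    refine commute_ext_prodWith h₁ he (fun c hc => ?_) (fun v hv => ?_) (fun v hv => ?_) hc
    · exact (commute_observables hPO ha hc).mul_left
        (commute_charged_observable (snd_mul_map h₂) hPO hu hc)
    · exact (commute_charged_observable (fst_mul_map h₁ he) hOP hv ha).symm.mul_left
        (commute_fst_snd he h₁ h₂ (by simpa using hP.symm) hv hu).symm
    · exact (commute_charged_observable (snd_mul_map h₂) hOP hv ha).symm.mul_left
        (commute_snd_snd hloc hPO hu hv)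
  have hb : (T₁.prodWith T₂ e).ι a * ((T₁.prodWith T₂ e).ι u *
      ((T₁.prodWith T₂ e).ι (star T₁.w) * (T₁.prodWith T₂ e).v)) =
      (((T₁.θ.comp T₂.θ).toHom a * ((T₁.θ.comp T₂.θ).toHom u * T₁.θ.toHom T₂.x) :
          A.quasi) : H →L[ℂ] H) := by
    rw [← snd_generator h₁ he]; rfl
  refine mem_sideCentre ?_ fun P hP c hc => ?_
  · obtain ⟨u₁, hu₁⟩ := T₁.θ.transportable O
    have hw : ((u₁ * T₁.w : A.quasi) : H →L[ℂ] H) ∈ A.alg O := by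
      simpa using Net.IsTransporter.one_id.intertwiner_mem hu₁ h₁.w_hom
    -- The field lies in C(O): the w₁* of v₂ = ι(w₁*)v is completed by u₁ to an observable in O, and
    -- w₁*θ₁(u) = uw₁*.
    refine ⟨a * star (u₁ * T₁.w), u₁ * T₁.θ.toHom u, mul_mem ha (star_mem hw), hu₁.comp hu, ?_⟩
    have : a * star (u₁ * T₁.w) * (u₁ * T₁.θ.toHom u) = a * u * star T₁.w := by
      rw [star_mul, mul_assoc, mul_assoc (star T₁.w), hu₁.star_mul_cancel_left,
        h₁.star_w_mul_map, mul_assoc]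
    simp only [← mul_assoc, ← map_mul, this]
  · rw [hb]
    refine ⟨hcomm P hP c hc a ha, ?_⟩
    obtain ⟨a', ha', h'⟩ := exists_star_charged h₂ (snd_mul_map (T₁ := T₁) h₂)
      (star_snd h₂) ha hu
    have := hcomm P hP c hc a' ha'
    rw [← h'] at this
    exact this

/-- If the first factor is local, it is contained in the centre of the braided product on the
side determined by the braiding. -/
theorem fstIn_subset_sideCentre (h₁ : T₁.IsQSystem) (h₂ : T₂.IsQSystem)
    (he : IsBraid d T₁.θ.toHom T₂.θ.toHom e) (hloc : IsLocalNet T₁.ext) (O : Region s) :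
    T₁.fstIn T₂ (T₁.prodWith T₂ e) O ⊆ sideCentre d (T₁.prodWith T₂ e).ext O := by
  rintro b ⟨a, u, ha, hu, rfl⟩
  have hcomm : ∀ P : Region s, OnSide d P O → ∀ c ∈ (T₁.prodWith T₂ e).ext P,
      ∀ a : A.quasi, (a : H →L[ℂ] H) ∈ A.alg O →
        Commute (((T₁.θ.comp T₂.θ).toHom a * ((T₁.θ.comp T₂.θ).toHom u *
          (T₁.θ.toHom e * T₁.x)) : A.quasi) : H →L[ℂ] H) c := by
    intro P hP c hc a ha
    have hPO := hP.subset_causalCompl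
    have hOP := hP.symm.subset_causalCompl
    refine commute_ext_prodWith h₁ he (fun c hc => ?_) (fun v hv => ?_) (fun v hv => ?_) hc
    · exact (commute_observables hPO ha hc).mul_left
        (commute_charged_observable (fst_mul_map h₁ he) hPO hu hc)
    · exact (commute_charged_observable (fst_mul_map h₁ he) hOP hv ha).symm.mul_left
        (commute_fst_fst hloc h₁ he hPO hu hv)
    · exact (commute_charged_observable (snd_mul_map h₂) hOP hv ha).symm.mul_left
        (commute_fst_snd he h₁ h₂ hP hu hv)
  have hb : (T₁.prodWith T₂ e).ι a * ((T₁.prodWith T₂ e).ι u *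
      ((T₁.prodWith T₂ e).ι (T₁.θ.toHom (star T₂.w)) * (T₁.prodWith T₂ e).v)) =
      (((T₁.θ.comp T₂.θ).toHom a * ((T₁.θ.comp T₂.θ).toHom u * (T₁.θ.toHom e * T₁.x)) :
          A.quasi) : H →L[ℂ] H) := by
    rw [← fst_generator h₁ h₂ he]; rfl
  refine mem_sideCentre ?_ fun P hP c hc => ?_
  · obtain ⟨u₂, hu₂⟩ := T₂.θ.transportable O
    have hw : ((u₂ * T₂.w : A.quasi) : H →L[ℂ] H) ∈ A.alg O := by
      simpa using Net.IsTransporter.one_id.intertwiner_mem hu₂ h₂.w_hom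
    -- Here the observable (u₂w₂)* sits behind θ₁; conjugation by u returns it to the local algebra
    -- of O.
    refine ⟨a * (u * T₁.θ.toHom (star (u₂ * T₂.w)) * star u), u * T₁.θ.toHom u₂,
      mul_mem ha (hu.conj_mem (star_mem hw)), hu.comp hu₂, ?_⟩
    have : a * (u * T₁.θ.toHom (star (u₂ * T₂.w)) * star u) * (u * T₁.θ.toHom u₂) =
        a * u * T₁.θ.toHom (star T₂.w) := by
      simp only [mul_assoc, hu.star_mul_cancel_left]
      rw [← map_mul, star_mul, mul_assoc, hu₂.star_mul_self, mul_one]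
    simp only [← mul_assoc] at this
    simp only [← mul_assoc, ← map_mul, this]
  · rw [hb]
    refine ⟨hcomm P hP c hc a ha, ?_⟩
    obtain ⟨a', ha', h'⟩ := exists_star_charged h₁ (fst_mul_map h₁ he) (star_fst h₁ he) ha hu
    have := hcomm P hP c hc a' ha'
    rw [← h'] at this
    exact this

end Product

end BraidedQFT

end

theorem lemma4p13 {s : BraidedQFT.Spacetime} {H : Type*} [NormedAddCommGroup H]
    [InnerProductSpace ℂ H] [CompleteSpace H] (A : BraidedQFT.Net s H)
    (A₁ A₂ : BraidedQFT.Triple A) (h₁ : A₁.IsQSystem) (h₂ : A₂.IsQSystem) :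
    (BraidedQFT.IsLocalNet A₂.ext → ∀ O : BraidedQFT.Region s,
      A₁.sndIn A₂ (A₁.prodPlus A₂) O ⊆ BraidedQFT.rightCentre (A₁.prodPlus A₂).ext O ∧
      A₁.sndIn A₂ (A₁.prodMinus A₂) O ⊆ BraidedQFT.leftCentre (A₁.prodMinus A₂).ext O) ∧
    (BraidedQFT.IsLocalNet A₁.ext → ∀ O : BraidedQFT.Region s,
      A₁.fstIn A₂ (A₁.prodPlus A₂) O ⊆ BraidedQFT.leftCentre (A₁.prodPlus A₂).ext O ∧
      A₁.fstIn A₂ (A₁.prodMinus A₂) O ⊆ BraidedQFT.rightCentre (A₁.prodMinus A₂).ext O) := by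
  have hp := BraidedQFT.braidPlus_isBraid A₁.θ A₂.θ
  have hm := BraidedQFT.braidMinus_isBraid A₁.θ A₂.θ
  -- The side is `true` for ε⁺ and `false` for ε⁻; the left and right centres are `sideCentre` at
  -- these values by definition.
  exact ⟨fun hloc O => ⟨BraidedQFT.sndIn_subset_sideCentre h₁ h₂ hp hloc O,
      BraidedQFT.sndIn_subset_sideCentre h₁ h₂ hm hloc O⟩,
    fun hloc O => ⟨BraidedQFT.fstIn_subset_sideCentre h₁ h₂ hp hloc O,
      BraidedQFT.fstIn_subset_sideCentre h₁ h₂ hm hloc O⟩⟩
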